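/- Let $G$ be a connected simple undirected $k$-regular graph on $n\ge 2$ vertices with adjacency matrix $A$, whose eigenvalues are $\lambda_1(A)\ge\lambda_2(A)\ge\dots\ge\lambda_n(A)$, and put $|\lambda'(A)|:=\max\{|\lambda_2(A)|,|\lambda_n(A)|\}$. Let $d>0$, and let $F:\mathbb R^n\times\mathbb R\to\mathbb R^n$ be either the Hopfield form $F(x,u)=-dx+uA\tanh(x)$ or the firing-rate form $F(x,u)=-dx+\tanh(uAx)$ of nonlinear opinion dynamics $\dot x=F(x,u)$ ($\tanh$ acts entrywise). Let $u^\star=d/k$, $J^\star=D_xF(0,u^\star)$, and let $P$ be the orthogonal projection onto $\operatorname{range}J^\star$. Then: 1. The system has a supercritical pitchfork bifurcation of equilibria at $(x,u)=(0,d/k)$. That is, $F(0,u^\star)=0$; $0$ is an eigenvalue of $J^\star$ of geometric and algebraic multiplicity one and all other eigenvalues of $J^\star$ have nonzero real part; and the scalar Lyapunov–Schmidt reduced function $g(t,u)=\langle w, F(tv+\varphi(tv,u),u)\rangle$, with a local implicit map $\varphi$ as in part 2 and unit vectors $v\in\ker J^\star$, $w\in(\operatorname{range}J^\star)^\perp$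 with $\langle w,v\rangle>0$, can be written near $(0,u^\star)$ as $g=S\cdot(\Lambda X-X^3)$ with smooth $S(t,u)>0$, $X(t,u)$, $\Lambda(u)$ such that $X(0,u^\star)=0$, $\Lambda(u^\star)=0$, $\partial_tX>0$, $\Lambda'>0$. Moreover $\ker J^\star=\operatorname{span}\{\mathbf 1_n\}$. 2. For all $R_\parallel,R_\perp$ with $$0<R_\parallel<\frac{d\,(k-\lambda_2(A))}{k\,|\lambda'(A)|},\qquad R_\perp>0,$$ the Lyapunov–Schmidt reduction at $(0,u^\star)$ is valid on the open Euclidean balls $B_\parallel\subset\ker J^\star\times\mathbb R$ of radius $R_\parallel$ about $(0,u^\star)$ and $B_\perp\subset(\ker J^\star)^\perp$ of radius $R_\perp$ about $0$. That is, there is a smooth map $\varphi:B_\parallel\to B_\perp$ with $\varphi(0,u^\star)=0$ such that for all $(\alpha,u)\in B_\parallel$ and $\beta\in B_\perp$ one has $P\,F(\alpha+\beta,u)=0$ if and only if $\beta=\varphi(\alpha,u)$; consequently $F(\alpha+\beta,u)=0$ if and only if $\beta=\varphi(\alpha,u)$ and the reduced equation $(I-P)F(\alpha+\varphi(\alpha,u),u)=0$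 holds. -/

import Mathlib

open scoped ContDiff

noncomputable section

namespace LSR

section General

variable {E : Type*} [NormedAddCommGroup E] [InnerProductSpace ℝ E] [FiniteDimensional ℝ E]

/-- The Jacobian `J⋆ = D_x Φ(x⋆, u⋆)` of a one-parameter family of vector fields `x' = Φ(x, u)`. -/
def jac (Φ : E → ℝ → E) (xs : E) (us : ℝ) : E →ₗ[ℝ] E :=
  (fderiv ℝ (fun x => Φ x us) xs : E →L[ℝ] E)

/-- The critical subspace `ker J⋆`. -/
abbrev critSpace (Φ : E → ℝ → E) (xs : E) (us : ℝ) : Submodule ℝ E :=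
  LinearMap.ker (jac Φ xs us)

/-- The subspace `range J⋆`. -/
abbrev rangeSpace (Φ : E → ℝ → E) (xs : E) (us : ℝ) : Submodule ℝ E :=
  LinearMap.range (jac Φ xs us)

/-- The open Euclidean ball of radius `R` in `ker J⋆ × ℝ`, centred at `(α₀, u⋆)`, where `α₀` is the
component of `x⋆` in `ker J⋆`. -/
def parBall (Φ : E → ℝ → E) (xs : E) (us R : ℝ) : Set (critSpace Φ xs us × ℝ) :=
  {z | √(‖z.1 - (critSpace Φ xs us).orthogonalProjectionOnto xs‖ ^ 2 + (z.2 - us) ^ 2) < R}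

/-- The open Euclidean ball of radius `R` in `(ker J⋆)ᗮ`, centred at the component `β₀` of `x⋆`. -/
def perpBall (Φ : E → ℝ → E) (xs : E) (us R : ℝ) : Set (critSpace Φ xs us)ᗮ :=
  Metric.ball ((critSpace Φ xs us)ᗮ.orthogonalProjectionOnto xs) R

/-- The Lyapunov–Schmidt reduction of `Φ = 0` at the singular point `(x⋆, u⋆)` is valid on the
balls of radii `Rpar` (in `ker J⋆ × ℝ`) and `Rperp` (in `(ker J⋆)ᗮ`), with implicit map `φ`.
States are written `x = α + β` with `α ∈ ker J⋆` and `β ∈ (ker J⋆)ᗮ`. -/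
structure IsValidReduction (Φ : E → ℝ → E) (xs : E) (us Rpar Rperp : ℝ)
    (φ : critSpace Φ xs us × ℝ → (critSpace Φ xs us)ᗮ) : Prop where
  smooth : ContDiffOn ℝ ∞ φ (parBall Φ xs us Rpar)
  mapsTo : Set.MapsTo φ (parBall Φ xs us Rpar) (perpBall Φ xs us Rperp)
  base : φ ((critSpace Φ xs us).orthogonalProjectionOnto xs, us) =
    (critSpace Φ xs us)ᗮ.orthogonalProjectionOnto xs
  /-- In the region, the graph of `φ` is exactly the solution set of the equation `Φ = 0`
  projected to `range J⋆`. -/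
  solves_iff : ∀ z ∈ parBall Φ xs us Rpar, ∀ β ∈ perpBall Φ xs us Rperp,
    (rangeSpace Φ xs us).starProjection (Φ (z.1 + β) z.2) = 0 ↔ β = φ z
  /-- In the region, the equilibria are the zeros `(α, u)` of the reduced equation, lifted
  by `φ`. -/
  equilibria_iff : ∀ z ∈ parBall Φ xs us Rpar, ∀ β ∈ perpBall Φ xs us Rperp,
    Φ (z.1 + β) z.2 = 0 ↔
      β = φ z ∧ (rangeSpace Φ xs us)ᗮ.starProjection (Φ (z.1 + φ z) z.2) = 0

end General

/-- A scalar bifurcation problem `g(t, u) = 0` is, near `(t₀, u₀)`, equivalent to the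
supercritical pitchfork normal form `Λ X - X³`: there are a smooth positive factor `S` and a smooth
orientation preserving change of coordinates `(t, u) ↦ (X (t, u), Λ u)` taking `(t₀, u₀)` to
`(0, 0)` such that `g = S * (Λ * X - X ^ 3)` near `(t₀, u₀)`. -/
def IsSupercriticalPitchforkGerm (g : ℝ → ℝ → ℝ) (t₀ u₀ : ℝ) : Prop :=
  ∃ (U : Set (ℝ × ℝ)) (I : Set ℝ) (S X : ℝ × ℝ → ℝ) (Λ : ℝ → ℝ),
    IsOpen U ∧ (t₀, u₀) ∈ U ∧ IsOpen I ∧ (∀ z ∈ U, z.2 ∈ I) ∧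
    ContDiffOn ℝ ∞ S U ∧ ContDiffOn ℝ ∞ X U ∧ ContDiffOn ℝ ∞ Λ I ∧
    X (t₀, u₀) = 0 ∧ Λ u₀ = 0 ∧
    (∀ z ∈ U, 0 < S z ∧ 0 < deriv (fun t => X (t, z.2)) z.1) ∧
    (∀ u ∈ I, 0 < deriv Λ u) ∧
    ∀ z ∈ U, g z.1 z.2 = S z * (Λ z.2 * X z - X z ^ 3)

/-- The family `x' = Φ(x, u)` has a supercritical pitchfork bifurcation of equilibria at
`(x⋆, u⋆)`: the point is an equilibrium, `0` is an eigenvalue of `J⋆` of geometric and algebraic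
multiplicity one, the other complex eigenvalues are off the imaginary axis, and the scalar
Lyapunov–Schmidt reduced equation, in unit vectors `v` of `ker J⋆` and `w` of `(range J⋆)ᗮ` with
`0 < ⟪w, v⟫`, is equivalent to the supercritical pitchfork normal form. -/
def IsSupercriticalPitchfork {E : Type*} [NormedAddCommGroup E] [InnerProductSpace ℝ E]
    [FiniteDimensional ℝ E] (Φ : E → ℝ → E) (xs : E) (us : ℝ) : Prop :=
  Φ xs us = 0 ∧
  Module.finrank ℝ (critSpace Φ xs us) = 1 ∧
  Module.finrank ℝ (Module.End.maxGenEigenspace (jac Φ xs us) 0) = 1 ∧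
  (∀ μ : ℂ, Polynomial.aeval μ (jac Φ xs us).charpoly = 0 → μ ≠ 0 → μ.re ≠ 0) ∧
  ∃ (v : critSpace Φ xs us) (w : ((rangeSpace Φ xs us)ᗮ : Submodule ℝ E)) (r ρ : ℝ)
    (φ : critSpace Φ xs us × ℝ → (critSpace Φ xs us)ᗮ),
    ‖v‖ = 1 ∧ ‖w‖ = 1 ∧ 0 < inner ℝ (w : E) (v : E) ∧ 0 < r ∧ 0 < ρ ∧
    IsValidReduction Φ xs us r ρ φ ∧
    IsSupercriticalPitchforkGerm
      (fun t u => inner ℝ (w : E) (Φ ((t • v : critSpace Φ xs us) + φ (t • v, u)) u))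
      (inner ℝ (v : E) xs) us

section Network

/-- The adjacency matrix of a simple graph is symmetric. -/
theorem adjMatrix_isHermitian {V : Type*} (G : SimpleGraph V) [DecidableRel G.Adj] :
    (G.adjMatrix ℝ).IsHermitian := by
  rw [Matrix.IsHermitian, Matrix.conjTranspose_eq_transpose_of_trivial]
  exact G.isSymm_adjMatrix

variable {V : Type*} [Fintype V] [DecidableEq V] (G : SimpleGraph V) [DecidableRel G.Adj]

/-- Hopfield form of nonlinear opinion dynamics, `Φ(x, u) = -d x + u A tanh(x)`. -/
def hopfieldNOD (d : ℝ) (x : EuclideanSpace ℝ V) (u : ℝ) : EuclideanSpace ℝ V :=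
  -(d • x) + u • WithLp.toLp 2 ((G.adjMatrix ℝ).mulVec fun j => Real.tanh (x j))

/-- Firing-rate form of nonlinear opinion dynamics, `Ψ(x, u) = -d x + tanh(u A x)`. -/
def firingNOD (d : ℝ) (x : EuclideanSpace ℝ V) (u : ℝ) : EuclideanSpace ℝ V :=
  -(d • x) + WithLp.toLp 2 (fun i => Real.tanh (u * (G.adjMatrix ℝ).mulVec (fun j => x j) i))

/-- The second largest eigenvalue `λ₂(A)` of the adjacency matrix, counted with multiplicity. -/
def lambdaTwo (h : 2 ≤ Fintype.card V) : ℝ :=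
  (adjMatrix_isHermitian G).eigenvalues₀ ⟨1, by omega⟩

/-- The smallest eigenvalue `λₙ(A)` of the adjacency matrix. -/
def lambdaMin (h : 2 ≤ Fintype.card V) : ℝ :=
  (adjMatrix_isHermitian G).eigenvalues₀ ⟨Fintype.card V - 1, by omega⟩

/-- `|λ'(A)| = max (|λ₂(A)|, |λₙ(A)|)`. -/
def lambdaPrime (h : 2 ≤ Fintype.card V) : ℝ :=
  max |lambdaTwo G h| |lambdaMin G h|

/-- The all-ones vector. -/
def ones (V : Type*) [Fintype V] : EuclideanSpace ℝ V := WithLp.toLp 2 fun _ => 1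

end Network

end LSR

end

/-! For `u` with `|u - d / k| * max |λ₂| |λₙ| < d * (k - λ₂) / k`, the quadratic form of `u A` is
less than `d ‖·‖²` on the complement of the consensus line `ℝ · 1`. As `tanh` is firmly nonexpansive
and maps the consensus line to itself, `F(x, u)` then lies on this line only if `x` does. So the
implicit map of the Lyapunov–Schmidt reduction is `φ = 0`, and the reduced equation is `F` on the
consensus line: up to a positive factor and a rescaling of `t`, it reads
`(1 - d / (u k)) t - (t - tanh t) = 0`. The analytic function `t - tanh t` has a zero of order
three at `0`, hence equals `t³ m(t)²` with `m > 0`, and `X = t m(t)` gives the normal form. -/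

namespace LSR

open Filter Topology
open scoped RealInnerProductSpace

section AnalyticFactorization

theorem exists_analyticAt_eventually_eq_sq {h : ℝ → ℝ} {x₀ : ℝ} (hh : AnalyticAt ℝ h x₀)
    (hpos : 0 < h x₀) :
    ∃ m : ℝ → ℝ, AnalyticAt ℝ m x₀ ∧ (∀ x, 0 < m x) ∧ ∀ᶠ x in 𝓝 x₀, h x = m x ^ 2 := by
  refine ⟨fun x => Real.exp (Real.log (h x) / 2), ?_, fun x => Real.exp_pos _, ?_⟩
  · have := hh.log hpos
    fun_prop
  · filter_upwards [hh.continuousAt.eventually (lt_mem_nhds hpos)] with x hx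
    rw [← Real.exp_nat_mul, Nat.cast_two, mul_div_cancel₀ _ two_ne_zero, Real.exp_log hx]

theorem exists_eventually_eq_pow_mul_sq {f : ℝ → ℝ} {x₀ : ℝ} {n : ℕ} (hf : AnalyticAt ℝ f x₀)
    (hn : analyticOrderAt f x₀ = n) (hpos : ∀ᶠ x in 𝓝[>] x₀, 0 ≤ f x) :
    ∃ m : ℝ → ℝ, AnalyticAt ℝ m x₀ ∧ (∀ x, 0 < m x) ∧
      ∀ᶠ x in 𝓝 x₀, f x = (x - x₀) ^ n * m x ^ 2 := by
  obtain ⟨h, hh, hne, hfh⟩ := hf.analyticOrderAt_eq_natCast.1 hn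
  have hnonneg : 0 ≤ h x₀ := by
    refine ge_of_tendsto (hh.continuousAt.tendsto.mono_left (nhdsWithin_le_nhds (s := Set.Ioi x₀)))
      ?_
    filter_upwards [nhdsWithin_le_nhds hfh, hpos, self_mem_nhdsWithin] with x hx hfx hx₀
    rw [hx, smul_eq_mul] at hfx
    exact nonneg_of_mul_nonneg_right hfx (pow_pos (sub_pos.2 hx₀) n)
  obtain ⟨m, hm, hmpos, hhm⟩ := exists_analyticAt_eventually_eq_sq hh (hnonneg.lt_of_ne' hne)
  refine ⟨m, hm, hmpos, ?_⟩
  filter_upwards [hfh, hhm] with x hx hxm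
  rw [hx, hxm, smul_eq_mul]

end AnalyticFactorization

section Germ

variable {g : ℝ → ℝ → ℝ} {t₀ u₀ : ℝ}

theorem IsSupercriticalPitchforkGerm.eq_zero (h : IsSupercriticalPitchforkGerm g t₀ u₀) :
    g t₀ u₀ = 0 := by
  obtain ⟨U, I, S, X, Λ, -, hU, -, -, -, -, -, hX, -, -, -, hg⟩ := h
  simpa [hX] using hg _ hU

/-- The reparametrisation `t ↦ κ u * t` is absorbed by `X` and the factor `M` by `S`. -/
theorem IsSupercriticalPitchforkGerm.of_eq_mul_comp_mul {M κ : ℝ → ℝ} {J : Set ℝ}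
    (h : IsSupercriticalPitchforkGerm g (κ u₀ * t₀) u₀) (hJ : IsOpen J) (hu₀ : u₀ ∈ J)
    (hM : ContDiffOn ℝ ∞ M J) (hκ : ContDiffOn ℝ ∞ κ J) (hMpos : ∀ u ∈ J, 0 < M u)
    (hκpos : ∀ u ∈ J, 0 < κ u) {g' : ℝ → ℝ → ℝ}
    (hg' : ∀ t, ∀ u ∈ J, g' t u = M u * g (κ u * t) u) :
    IsSupercriticalPitchforkGerm g' t₀ u₀ := by
  obtain ⟨U, I, S, X, Λ, hU, hmem, hI, hUI, hS, hX, hΛ, hX₀, hΛ₀, hpos, hΛpos, hg⟩ := h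
  let σ : ℝ × ℝ → ℝ × ℝ := fun z => (κ z.2 * z.1, z.2)
  let D : Set (ℝ × ℝ) := Prod.snd ⁻¹' J
  have hD : IsOpen D := hJ.preimage continuous_snd
  have hsnd : Set.MapsTo Prod.snd D J := fun z hz => hz
  have hσ : ContDiffOn ℝ ∞ σ D :=
    ((hκ.comp contDiffOn_snd hsnd).mul contDiffOn_fst).prodMk contDiffOn_snd
  have hσD : ContDiffOn ℝ ∞ σ (D ∩ σ ⁻¹' U) := hσ.mono Set.inter_subset_left
  have hσU : Set.MapsTo σ (D ∩ σ ⁻¹' U) U := fun z hz => hz.2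
  refine ⟨D ∩ σ ⁻¹' U, I, fun z => M z.2 * S (σ z), X ∘ σ, Λ,
    hσ.continuousOn.isOpen_inter_preimage hD hU, ⟨hu₀, hmem⟩, hI, fun z hz => hUI (σ z) hz.2,
    ?_, hX.comp hσD hσU, hΛ, hX₀, hΛ₀, fun z hz => ⟨?_, ?_⟩, hΛpos, fun z hz => ?_⟩
  · exact (hM.comp contDiffOn_snd fun z hz => hz.1).mul (hS.comp hσD hσU)
  · exact mul_pos (hMpos _ hz.1) (hpos _ hz.2).1
  · change 0 < deriv (fun t => (fun s => X (s, z.2)) (κ z.2 * t)) z.1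
    rw [deriv_comp_mul_left (κ z.2) (fun s => X (s, z.2)), smul_eq_mul]
    exact mul_pos (hκpos _ hz.1) (hpos _ hz.2).2
  · rw [hg' _ _ hz.1, hg _ hz.2, mul_assoc]
    rfl

/-- Writing `f t = t ^ 3 * m t ^ 2`, the normal form has `X = t * m t` and `S = 1 / m t`. -/
theorem isSupercriticalPitchforkGerm_mul_sub {f Λ : ℝ → ℝ} {I : Set ℝ} (hf : AnalyticAt ℝ f 0)
    (hord : analyticOrderAt f 0 = 3) (hfpos : ∀ᶠ t in 𝓝[>] 0, 0 ≤ f t) (hI : IsOpen I)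
    (hu₀ : u₀ ∈ I) (hΛ : ContDiffOn ℝ ∞ Λ I) (hΛ₀ : Λ u₀ = 0) (hΛpos : ∀ u ∈ I, 0 < deriv Λ u) :
    IsSupercriticalPitchforkGerm (fun t u => Λ u * t - f t) 0 u₀ := by
  obtain ⟨m, hm, hmpos, hfm⟩ := exists_eventually_eq_pow_mul_sq (n := 3) hf hord hfpos
  have hX : AnalyticAt ℝ (fun t => t * m t) 0 := analyticAt_id.fun_mul hm
  have hX₀ : 0 < deriv (fun t => t * m t) 0 := by
    rw [deriv_fun_mul differentiableAt_fun_id hm.differentiableAt]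
    simpa using hmpos 0
  obtain ⟨W, hW, hWo, hW₀⟩ := eventually_nhds_iff.1 <| hm.eventually_analyticAt.and <|
    (hX.deriv.continuousAt.eventually (lt_mem_nhds hX₀)).and hfm
  have hmW : ContDiffOn ℝ ∞ m W := fun t ht => (hW t ht).1.contDiffAt.contDiffWithinAt
  have hmWI : ContDiffOn ℝ ∞ (fun z : ℝ × ℝ => m z.1) (W ×ˢ I) :=
    hmW.comp contDiffOn_fst fun z hz => hz.1
  refine ⟨W ×ˢ I, I, fun z => (m z.1)⁻¹, fun z => z.1 * m z.1, Λ, hWo.prod hI, ⟨hW₀, hu₀⟩, hI,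
    fun z hz => hz.2, hmWI.inv fun z _ => (hmpos z.1).ne', contDiffOn_fst.mul hmWI, hΛ,
    zero_mul _, hΛ₀, fun z hz => ⟨inv_pos.2 (hmpos z.1), (hW _ hz.1).2.1⟩, hΛpos, fun z hz => ?_⟩
  have hfz : f z.1 = z.1 ^ 3 * m z.1 ^ 2 := by simpa using (hW _ hz.1).2.2
  have hmz : m z.1 ≠ 0 := (hmpos z.1).ne'
  change Λ z.2 * z.1 - f z.1 = (m z.1)⁻¹ * (Λ z.2 * (z.1 * m z.1) - (z.1 * m z.1) ^ 3)
  rw [hfz]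
  field_simp

end Germ

/-- Firmly nonexpansive (equivalently, `1`-cocoercive) maps of an inner product space. -/
def FirmlyNonexpansive {E : Type*} [NormedAddCommGroup E] [InnerProductSpace ℝ E]
    (T : E → E) : Prop :=
  ∀ x y, ‖T x - T y‖ ^ 2 ≤ ⟪x - y, T x - T y⟫

theorem firmlyNonexpansive_of_monotone {f : ℝ → ℝ} (hf : Monotone f)
    (hf' : Monotone fun x => x - f x) : FirmlyNonexpansive f := by
  intro x y
  rw [Real.norm_eq_abs, sq_abs, real_inner_eq_re_inner, RCLike.inner_apply]
  simp only [conj_trivial, RCLike.re_to_real]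
  rcases le_total x y with h | h <;> nlinarith [hf h, hf' h]

section Tanh

theorem hasDerivAt_tanh (x : ℝ) : HasDerivAt Real.tanh (1 - Real.tanh x ^ 2) x := by
  have hcosh : Real.cosh x ≠ 0 := (Real.cosh_pos x).ne'
  rw [funext Real.tanh_eq_sinh_div_cosh]
  refine ((Real.hasDerivAt_sinh x).fun_div (Real.hasDerivAt_cosh x) hcosh).congr_deriv ?_
  field_simp

theorem hasDerivAt_sub_tanh (x : ℝ) :
    HasDerivAt (fun x => x - Real.tanh x) (Real.tanh x ^ 2) x :=
  ((hasDerivAt_id x).sub (hasDerivAt_tanh x)).congr_deriv (sub_sub_cancel _ _)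

theorem strictMono_tanh : StrictMono Real.tanh :=
  strictMono_of_hasDerivAt_pos hasDerivAt_tanh fun x => sub_pos.2 (Real.tanh_sq_lt_one x)

theorem monotone_sub_tanh : Monotone fun x => x - Real.tanh x :=
  monotone_of_hasDerivAt_nonneg hasDerivAt_sub_tanh fun x => sq_nonneg (Real.tanh x)

theorem firmlyNonexpansive_tanh : FirmlyNonexpansive Real.tanh :=
  firmlyNonexpansive_of_monotone strictMono_tanh.monotone monotone_sub_tanh

theorem analyticAt_tanh (x : ℝ) : AnalyticAt ℝ Real.tanh x := by
  rw [funext Real.tanh_eq_sinh_div_cosh]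
  exact Real.analyticAt_sinh.fun_div Real.analyticAt_cosh (Real.cosh_pos x).ne'

theorem analyticOrderAt_tanh_zero : analyticOrderAt Real.tanh 0 = 1 :=
  (analyticAt_tanh 0).analyticOrderAt_eq_one_of_zero_deriv_ne_zero Real.tanh_zero
    (by simp [(hasDerivAt_tanh 0).deriv])

theorem analyticOrderAt_sub_tanh_zero :
    analyticOrderAt (fun x => x - Real.tanh x) 0 = 3 := by
  have hf : AnalyticAt ℝ (fun x => x - Real.tanh x) 0 := analyticAt_id.fun_sub (analyticAt_tanh 0)
  have hderiv : deriv (fun x => x - Real.tanh x) = Real.tanh ^ 2 :=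
    funext fun x => (hasDerivAt_sub_tanh x).deriv
  have hord := hf.analyticOrderAt_deriv_add_one
  rw [hderiv, analyticOrderAt_pow (analyticAt_tanh 0), analyticOrderAt_tanh_zero] at hord
  simp only [Real.tanh_zero, sub_zero] at hord
  rw [← hord]
  norm_num

variable {d κ : ℝ}

theorem isSupercriticalPitchforkGerm_tanh (hd : 0 < d) (hκ : 0 < κ) :
    IsSupercriticalPitchforkGerm (fun t u => (1 - d / (u * κ)) * t - (t - Real.tanh t)) 0
      (d / κ) := by
  have hne : ∀ u ∈ Set.Ioi (0 : ℝ), u * κ ≠ 0 := fun u hu => (mul_pos hu hκ).ne'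
  refine isSupercriticalPitchforkGerm_mul_sub (I := Set.Ioi 0) (Λ := fun u => 1 - d / (u * κ))
    (analyticAt_id.fun_sub (analyticAt_tanh 0)) analyticOrderAt_sub_tanh_zero ?_ isOpen_Ioi
    (div_pos hd hκ) (contDiffOn_const.sub (contDiffOn_const.div (by fun_prop) hne))
    (by field_simp; simp) fun u hu => ?_
  · filter_upwards [self_mem_nhdsWithin] with t ht
    simpa using monotone_sub_tanh (Set.mem_Ioi.1 ht).le
  · have hΛ := ((hasDerivAt_const u d).fun_div ((hasDerivAt_id' u).mul_const κ)
      (hne u hu)).const_sub 1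
    rw [hΛ.deriv]
    have : 0 < u := hu
    field_simp
    nlinarith

theorem isSupercriticalPitchforkGerm_hopfield (hd : 0 < d) (hκ : 0 < κ) :
    IsSupercriticalPitchforkGerm (fun t u => -(d * t) + u * (κ * Real.tanh t)) 0 (d / κ) := by
  refine .of_eq_mul_comp_mul (J := Set.Ioi 0) (M := fun u => u * κ) (κ := fun _ => 1)
    (by simpa using isSupercriticalPitchforkGerm_tanh hd hκ) isOpen_Ioi (div_pos hd hκ)
    (by fun_prop) (by fun_prop) (fun u hu => mul_pos hu hκ) (fun _ _ => one_pos) fun t u hu => ?_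
  have : u ≠ 0 := hu.ne'
  field_simp
  ring

theorem isSupercriticalPitchforkGerm_firing (hd : 0 < d) (hκ : 0 < κ) :
    IsSupercriticalPitchforkGerm (fun t u => -(d * t) + Real.tanh (u * (κ * t))) 0 (d / κ) := by
  refine .of_eq_mul_comp_mul (J := Set.Ioi 0) (M := fun _ => 1) (κ := fun u => u * κ)
    (by simpa using isSupercriticalPitchforkGerm_tanh hd hκ) isOpen_Ioi (div_pos hd hκ)
    (by fun_prop) (by fun_prop) (fun _ _ => one_pos) (fun u hu => mul_pos hu hκ) fun t u hu => ?_
  have : u ≠ 0 := hu.ne'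
  rw [mul_assoc u κ t]
  field_simp
  ring

end Tanh

section Transversality

variable {E : Type*} [NormedAddCommGroup E] [InnerProductSpace ℝ E] {K : Submodule ℝ E}
  [K.HasOrthogonalProjection] {B : E →ₗ[ℝ] E} {T : E → E} {d : ℝ}

theorem starProjection_orthogonal_map (hB : B.IsSymmetric) (hBK : ∀ x ∈ K, B x ∈ K) (x : E) :
    Kᗮ.starProjection (B x) = B (Kᗮ.starProjection x) := by
  refine Submodule.eq_starProjection_of_mem_orthogonal' (z := B (K.starProjection x))
    (hB.orthogonalComplement_mem_invtSubmodule hBK (Submodule.starProjection_apply_mem _ x))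
    (Submodule.le_orthogonal_orthogonal K (hBK _ (Submodule.starProjection_apply_mem _ x))) ?_
  rw [← map_add, add_comm, Submodule.starProjection_add_starProjection_orthogonal]

/-- With `z` the component of `y` in `Kᗮ`, one has
`d‖z‖² ≤ d‖y‖² ≤ d⟪w, y⟫ = ⟪z, B z⟫`, against the strict bound on `B`. -/
theorem starProjection_orthogonal_eq_zero_of_norm_sq_le {w y : E} (hd : 0 ≤ d)
    (hBd : ∀ z ∈ Kᗮ, z ≠ 0 → ⟪z, B z⟫ < d * ‖z‖ ^ 2) (hw : w ∈ Kᗮ) (hy : ‖y‖ ^ 2 ≤ ⟪w, y⟫)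
    (h : d • w = B (Kᗮ.starProjection y)) : Kᗮ.starProjection y = 0 := by
  set z := Kᗮ.starProjection y
  by_contra hz
  have hzy : ⟪w, z⟫ = ⟪w, y⟫ := by
    rw [← Submodule.inner_starProjection_left_eq_right,
      Submodule.starProjection_eq_self_iff.2 hw]
  have hznorm : ‖z‖ ^ 2 ≤ ‖y‖ ^ 2 := by
    gcongr
    exact Kᗮ.norm_starProjection_apply_le y
  have hlower : d * ‖z‖ ^ 2 ≤ ⟪z, B z⟫ :=
    calc d * ‖z‖ ^ 2 ≤ d * ⟪w, z⟫ := by rw [hzy]; gcongr; exact hznorm.trans hy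
      _ = ⟪z, B z⟫ := by rw [← real_inner_smul_left, h, real_inner_comm]
  exact (hBd z (Submodule.starProjection_apply_mem _ y) hz).not_ge hlower

theorem starProjection_orthogonal_eq_zero_iff {x : E} : Kᗮ.starProjection x = 0 ↔ x ∈ K := by
  rw [Submodule.starProjection_apply_eq_zero_iff, Submodule.orthogonal_orthogonal]

theorem neg_smul_add_map_mem_iff (hd : 0 < d) (hB : B.IsSymmetric) (hBK : ∀ x ∈ K, B x ∈ K)
    (hBd : ∀ z ∈ Kᗮ, z ≠ 0 → ⟪z, B z⟫ < d * ‖z‖ ^ 2) (hT : FirmlyNonexpansive T)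
    (hTK : ∀ x ∈ K, T x ∈ K) {x : E} : -(d • x) + B (T x) ∈ K ↔ x ∈ K := by
  refine ⟨fun h => ?_, fun h => add_mem (neg_mem (K.smul_mem d h)) (hBK _ (hTK x h))⟩
  set α := K.starProjection x
  have hα : α ∈ K := Submodule.starProjection_apply_mem _ x
  have hβ : Kᗮ.starProjection x = x - α := Submodule.starProjection_orthogonal_val x
  have hy : Kᗮ.starProjection (T x - T α) = Kᗮ.starProjection (T x) := by
    rw [map_sub, starProjection_orthogonal_eq_zero_iff.2 (hTK α hα), sub_zero]
  have heq : d • (x - α) = B (Kᗮ.starProjection (T x - T α)) := by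
    rw [hy, ← starProjection_orthogonal_map hB hBK, ← hβ, ← map_smul, ← sub_eq_zero, ← map_sub,
      starProjection_orthogonal_eq_zero_iff, ← neg_mem_iff]
    convert h using 1
    abel
  have hzero := starProjection_orthogonal_eq_zero_of_norm_sq_le hd.le hBd
    (hβ ▸ Submodule.starProjection_apply_mem _ x) (hT x α) heq
  rw [hzero, map_zero, smul_eq_zero_iff_right hd.ne', sub_eq_zero] at heq
  exact heq ▸ hα

theorem neg_smul_add_comp_mem_iff (hd : 0 < d) (hB : B.IsSymmetric) (hBK : ∀ x ∈ K, B x ∈ K)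
    (hBd : ∀ z ∈ Kᗮ, z ≠ 0 → ⟪z, B z⟫ < d * ‖z‖ ^ 2) (hT : FirmlyNonexpansive T)
    (hTK : ∀ x ∈ K, T x ∈ K) {x : E} : -(d • x) + T (B x) ∈ K ↔ x ∈ K := by
  refine ⟨fun h => ?_, fun h => add_mem (neg_mem (K.smul_mem d h)) (hTK _ (hBK x h))⟩
  set α := K.starProjection x
  have hα : α ∈ K := Submodule.starProjection_apply_mem _ x
  have hβ : Kᗮ.starProjection x = x - α := Submodule.starProjection_orthogonal_val x
  have hy : Kᗮ.starProjection (T (B x) - T (B α)) = d • (x - α) := by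
    rw [map_sub, starProjection_orthogonal_eq_zero_iff.2 (hTK _ (hBK α hα)), sub_zero, ← hβ,
      ← map_smul, ← sub_eq_zero, ← map_sub, starProjection_orthogonal_eq_zero_iff]
    convert h using 1
    abel
  have hBβ : B x - B α ∈ Kᗮ := by
    rw [← map_sub, ← hβ, ← starProjection_orthogonal_map hB hBK]
    exact Submodule.starProjection_apply_mem _ _
  have hzero := starProjection_orthogonal_eq_zero_of_norm_sq_le hd.le hBd hBβ (hT (B x) (B α))
    (by rw [hy, map_smul, map_sub])
  rw [hy, smul_eq_zero_iff_right hd.ne', sub_eq_zero] at hzero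
  exact hzero ▸ hα

end Transversality

section SymmetricOperator

variable {E : Type*} [NormedAddCommGroup E] [InnerProductSpace ℝ E] {J : E →ₗ[ℝ] E}

theorem maxGenEigenspace_zero_eq_ker (hJ : J.IsSymmetric) :
    Module.End.maxGenEigenspace J 0 = LinearMap.ker J := by
  rw [hJ.isFinitelySemisimple.maxGenEigenspace_eq_eigenspace, Module.End.eigenspace_zero]

theorem im_eq_zero_of_aeval_charpoly_eq_zero [FiniteDimensional ℝ E] (hJ : J.IsSymmetric) {μ : ℂ}
    (hμ : Polynomial.aeval μ J.charpoly = 0) : μ.im = 0 := by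
  rw [hJ.charpoly_eq rfl, map_prod, Finset.prod_eq_zero_iff] at hμ
  obtain ⟨i, -, hi⟩ := hμ
  simp only [map_sub, Polynomial.aeval_X, Polynomial.aeval_C, sub_eq_zero] at hi
  simp [hi]

end SymmetricOperator

section Reduction

variable {E : Type*} [NormedAddCommGroup E] [InnerProductSpace ℝ E] [FiniteDimensional ℝ E]
  {Φ : E → ℝ → E} {xs : E} {us R ρ : ℝ}

theorem abs_sub_lt_of_mem_parBall {z : critSpace Φ xs us × ℝ} (hz : z ∈ parBall Φ xs us R) :
    |z.2 - us| < R :=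
  (Real.abs_le_sqrt (le_add_of_nonneg_left (sq_nonneg _))).trans_lt hz

theorem isValidReduction_zero (hρ : 0 < ρ) (hxs : xs ∈ critSpace Φ xs us)
    (hJ : (rangeSpace Φ xs us)ᗮ = critSpace Φ xs us)
    (hΦ : ∀ u, |u - us| < R → ∀ x, Φ x u ∈ critSpace Φ xs us ↔ x ∈ critSpace Φ xs us) :
    IsValidReduction Φ xs us R ρ 0 := by
  have hmem : ∀ (α : critSpace Φ xs us) (β : (critSpace Φ xs us)ᗮ),
      (α + β : E) ∈ critSpace Φ xs us ↔ β = 0 := fun α β => by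
    rw [Submodule.add_mem_iff_right _ α.2, ← starProjection_orthogonal_eq_zero_iff,
      Submodule.starProjection_eq_self_iff.2 β.2, ZeroMemClass.coe_eq_zero]
  have hbase : (critSpace Φ xs us)ᗮ.orthogonalProjectionOnto xs = 0 :=
    Submodule.orthogonalProjectionOnto_eq_zero_iff.2 (Submodule.le_orthogonal_orthogonal _ hxs)
  have hsolves : ∀ z ∈ parBall Φ xs us R, ∀ β ∈ perpBall Φ xs us ρ,
      (rangeSpace Φ xs us).starProjection (Φ (z.1 + β) z.2) = 0 ↔ β = 0 := fun z hz β _ => by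
    rw [Submodule.starProjection_apply_eq_zero_iff, hJ, hΦ _ (abs_sub_lt_of_mem_parBall hz), hmem]
  refine ⟨contDiffOn_const, fun z _ => ?_, hbase.symm, hsolves, fun z hz β hβ => ?_⟩
  · simpa [perpBall, hbase] using hρ
  · refine ⟨fun h => ?_, ?_⟩
    · obtain rfl := (hsolves z hz β hβ).1 (by rw [h, map_zero])
      exact ⟨rfl, by rw [Pi.zero_apply, h, map_zero]⟩
    · rintro ⟨rfl, h⟩
      have hz' : Φ (z.1 + (0 : (critSpace Φ xs us)ᗮ)) z.2 ∈ (rangeSpace Φ xs us)ᗮ := by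
        rw [hJ, hΦ _ (abs_sub_lt_of_mem_parBall hz), hmem]
      rwa [Pi.zero_apply, Submodule.starProjection_eq_self_iff.2 hz'] at h

theorem isSupercriticalPitchfork_of_line {e : E} (he : e ≠ 0) (hR : 0 < R)
    (hJ : (jac Φ 0 us).IsSymmetric) (hker : critSpace Φ 0 us = ℝ ∙ e)
    (hΦ : ∀ u, |u - us| < R → ∀ x, Φ x u ∈ ℝ ∙ e ↔ x ∈ ℝ ∙ e) {γ : ℝ → ℝ → ℝ}
    (hγ : ∀ a u, Φ (a • e) u = γ a u • e) (hgerm : IsSupercriticalPitchforkGerm γ 0 us) :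
    IsSupercriticalPitchfork Φ 0 us := by
  have hnorm : 0 < ‖e‖ := norm_pos_iff.2 he
  have hrange : (rangeSpace Φ 0 us)ᗮ = ℝ ∙ e := hJ.orthogonal_range.trans hker
  have hrank : Module.finrank ℝ (critSpace Φ 0 us) = 1 := by rw [hker, finrank_span_singleton he]
  set v : E := ‖e‖⁻¹ • e
  have hv : v ∈ ℝ ∙ e := Submodule.smul_mem _ _ (Submodule.mem_span_singleton_self e)
  have hv1 : ‖v‖ = 1 := norm_smul_inv_norm (𝕜 := ℝ) he
  refine ⟨by simpa [hgerm.eq_zero] using hγ 0 us, hrank,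
    by rwa [maxGenEigenspace_zero_eq_ker hJ], fun μ hμ hμ₀ hre =>
      hμ₀ (Complex.ext hre (im_eq_zero_of_aeval_charpoly_eq_zero hJ hμ)),
    ⟨v, hker ▸ hv⟩, ⟨v, hrange ▸ hv⟩, R, 1, 0, hv1, hv1, ?_, hR, one_pos,
    isValidReduction_zero one_pos (zero_mem _) hJ.orthogonal_range (hker ▸ hΦ), ?_⟩
  · simp [hv1]
  · rw [inner_zero_right]
    refine .of_eq_mul_comp_mul (J := Set.univ) (M := fun _ => ‖e‖) (κ := fun _ => ‖e‖⁻¹)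
      (by simpa using hgerm) isOpen_univ (Set.mem_univ _) contDiffOn_const contDiffOn_const
      (fun _ _ => hnorm) (fun _ _ => inv_pos.2 hnorm) fun t u _ => ?_
    have htv : t • v = (‖e‖⁻¹ * t) • e := by rw [smul_smul, mul_comm]
    have hve : ⟪v, e⟫ = ‖e‖ := by
      rw [real_inner_smul_left, real_inner_self_eq_norm_mul_norm, inv_mul_cancel_left₀ hnorm.ne']
    simp only [Pi.zero_apply, Submodule.coe_smul, Submodule.coe_zero, add_zero, htv, hγ,
      real_inner_smul_right, hve]
    rw [mul_comm]

end Reduction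

section OpinionDynamics

variable {E : Type*} [NormedAddCommGroup E] [InnerProductSpace ℝ E]

/-- Hopfield form `-d x + u A T(x)` of nonlinear opinion dynamics, with saturation `T`. -/
def hopfieldField (A : E →L[ℝ] E) (T : E → E) (d : ℝ) (x : E) (u : ℝ) : E :=
  -(d • x) + u • A (T x)

/-- Firing-rate form `-d x + T(u A x)` of nonlinear opinion dynamics, with saturation `T`. -/
def firingField (A : E →L[ℝ] E) (T : E → E) (d : ℝ) (x : E) (u : ℝ) : E :=
  -(d • x) + T (u • A x)

/-- The vector `e` spans the eigenline of the symmetric operator `A` at its largest eigenvalue `κ`: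
the quadratic form of `A` is at most `l < κ`, and at most `L` in absolute value, on `eᗮ`. -/
structure IsDominantMode (A : E →L[ℝ] E) (e : E) (κ l L : ℝ) : Prop where
  isSymmetric : (A : E →ₗ[ℝ] E).IsSymmetric
  ne_zero : e ≠ 0
  apply_eq : A e = κ • e
  lt : l < κ
  inner_le : ∀ z ∈ (ℝ ∙ e)ᗮ, ⟪z, A z⟫ ≤ l * ‖z‖ ^ 2
  abs_inner_le : ∀ z ∈ (ℝ ∙ e)ᗮ, |⟪z, A z⟫| ≤ L * ‖z‖ ^ 2

variable {A : E →L[ℝ] E} {T : E → E} {e : E} {κ l L d u : ℝ} {Φ : E → ℝ → E} {γ : ℝ → ℝ → ℝ}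

namespace IsDominantMode

theorem map_mem (h : IsDominantMode A e κ l L) (u : ℝ) :
    ∀ x ∈ ℝ ∙ e, (u • (A : E →ₗ[ℝ] E)) x ∈ ℝ ∙ e := by
  intro x hx
  obtain ⟨a, rfl⟩ := Submodule.mem_span_singleton.1 hx
  have hA : (u • (A : E →ₗ[ℝ] E)) (a • e) = (u * a * κ) • e := by
    simp [h.apply_eq, smul_smul, mul_left_comm, mul_assoc]
  exact hA ▸ Submodule.smul_mem _ _ (Submodule.mem_span_singleton_self e)

theorem apply_eq_smul_iff (h : IsDominantMode A e κ l L) {x : E} :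
    A x = κ • x ↔ x ∈ ℝ ∙ e := by
  refine ⟨fun hx => ?_, fun hx => ?_⟩
  · set z := (ℝ ∙ e)ᗮ.starProjection x with hz
    have hAz : A z = κ • z := by
      have := starProjection_orthogonal_map h.isSymmetric (by simpa using h.map_mem 1) x
      rwa [ContinuousLinearMap.coe_coe, hx, map_smul, eq_comm] at this
    have hle : κ * ‖z‖ ^ 2 ≤ l * ‖z‖ ^ 2 := by
      simpa [hAz, real_inner_smul_right] using
        h.inner_le z (Submodule.starProjection_apply_mem _ x)
    rw [← starProjection_orthogonal_eq_zero_iff, ← hz, ← norm_eq_zero]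
    by_contra hne
    exact hle.not_gt (mul_lt_mul_of_pos_right h.lt (by positivity))
  · obtain ⟨a, rfl⟩ := Submodule.mem_span_singleton.1 hx
    rw [map_smul, h.apply_eq, smul_comm]

/-- Split `u = (u - d / κ) + d / κ` and bound the first part by `L`, the second by `l`. -/
theorem inner_smul_lt (h : IsDominantMode A e κ l L) (hd : 0 ≤ d) (hκ : 0 < κ)
    (hu : |u - d / κ| * L < d * (κ - l) / κ) :
    ∀ z ∈ (ℝ ∙ e)ᗮ, z ≠ 0 → ⟪z, (u • (A : E →ₗ[ℝ] E)) z⟫ < d * ‖z‖ ^ 2 := by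
  intro z hz hz₀
  have : 0 < ‖z‖ ^ 2 := pow_pos (norm_pos_iff.2 hz₀) 2
  calc ⟪z, (u • (A : E →ₗ[ℝ] E)) z⟫ = (u - d / κ) * ⟪z, A z⟫ + d / κ * ⟪z, A z⟫ := by
        rw [LinearMap.smul_apply, real_inner_smul_right, ContinuousLinearMap.coe_coe]
        ring
    _ ≤ |u - d / κ| * (L * ‖z‖ ^ 2) + d / κ * (l * ‖z‖ ^ 2) := by
        refine add_le_add ?_ (mul_le_mul_of_nonneg_left (h.inner_le z hz) (by positivity))
        refine (le_abs_self _).trans ?_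
        rw [abs_mul]
        exact mul_le_mul_of_nonneg_left (h.abs_inner_le z hz) (abs_nonneg _)
    _ = (|u - d / κ| * L) * ‖z‖ ^ 2 + d / κ * (l * ‖z‖ ^ 2) := by ring
    _ < d * (κ - l) / κ * ‖z‖ ^ 2 + d / κ * (l * ‖z‖ ^ 2) := by gcongr
    _ = d * ‖z‖ ^ 2 := by field_simp; ring

theorem hopfieldField_mem_iff (h : IsDominantMode A e κ l L) (hd : 0 < d) (hκ : 0 < κ)
    (hT : FirmlyNonexpansive T) (hTe : ∀ x ∈ ℝ ∙ e, T x ∈ ℝ ∙ e)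
    (hu : |u - d / κ| * L < d * (κ - l) / κ) (x : E) :
    hopfieldField A T d x u ∈ ℝ ∙ e ↔ x ∈ ℝ ∙ e :=
  neg_smul_add_map_mem_iff hd (h.isSymmetric.smul (by simp)) (h.map_mem u)
    (h.inner_smul_lt hd.le hκ hu) hT hTe

theorem firingField_mem_iff (h : IsDominantMode A e κ l L) (hd : 0 < d) (hκ : 0 < κ)
    (hT : FirmlyNonexpansive T) (hTe : ∀ x ∈ ℝ ∙ e, T x ∈ ℝ ∙ e)
    (hu : |u - d / κ| * L < d * (κ - l) / κ) (x : E) :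
    firingField A T d x u ∈ ℝ ∙ e ↔ x ∈ ℝ ∙ e :=
  neg_smul_add_comp_mem_iff hd (h.isSymmetric.smul (by simp)) (h.map_mem u)
    (h.inner_smul_lt hd.le hκ hu) hT hTe

theorem jac_isSymmetric (h : IsDominantMode A e κ l L)
    (hjac : jac Φ 0 u = u • (A : E →ₗ[ℝ] E) - d • LinearMap.id) : (jac Φ 0 u).IsSymmetric :=
  hjac ▸ (h.isSymmetric.smul (by simp)).sub (LinearMap.IsSymmetric.id.smul (by simp))

theorem critSpace_eq (h : IsDominantMode A e κ l L) (hd : d ≠ 0) (hκ : κ ≠ 0)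
    (hjac : jac Φ 0 (d / κ) = (d / κ) • (A : E →ₗ[ℝ] E) - d • LinearMap.id) :
    critSpace Φ 0 (d / κ) = ℝ ∙ e := by
  ext x
  have hx : jac Φ 0 (d / κ) x = (d / κ) • (A x - κ • x) := by
    rw [hjac, smul_sub, smul_smul, div_mul_cancel₀ _ hκ]
    rfl
  rw [LinearMap.mem_ker, hx, smul_eq_zero_iff_right (div_ne_zero hd hκ), sub_eq_zero,
    h.apply_eq_smul_iff]

variable [FiniteDimensional ℝ E]

theorem isValidReduction (h : IsDominantMode A e κ l L) (hd : 0 < d) (hκ : 0 < κ)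
    (hjac : jac Φ 0 (d / κ) = (d / κ) • (A : E →ₗ[ℝ] E) - d • LinearMap.id)
    (hΦ : ∀ u, |u - d / κ| * L < d * (κ - l) / κ → ∀ x, Φ x u ∈ ℝ ∙ e ↔ x ∈ ℝ ∙ e)
    {R ρ : ℝ} (hR : R < d * (κ - l) / (κ * L)) (hρ : 0 < ρ) :
    IsValidReduction Φ 0 (d / κ) R ρ 0 := by
  refine isValidReduction_zero hρ (zero_mem _) (h.jac_isSymmetric hjac).orthogonal_range
    fun u hu x => ?_
  rw [h.critSpace_eq hd.ne' hκ.ne' hjac]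
  refine hΦ u ?_ x
  have hgap : 0 < d * (κ - l) / κ := div_pos (mul_pos hd (sub_pos.2 h.lt)) hκ
  rcases le_or_gt L 0 with hL | hL
  · exact (mul_nonpos_of_nonneg_of_nonpos (abs_nonneg _) hL).trans_lt hgap
  · rw [← lt_div_iff₀ hL, div_div]
    exact hu.trans hR

theorem isSupercriticalPitchfork (h : IsDominantMode A e κ l L) (hd : 0 < d) (hκ : 0 < κ)
    (hjac : jac Φ 0 (d / κ) = (d / κ) • (A : E →ₗ[ℝ] E) - d • LinearMap.id)
    (hΦ : ∀ u, |u - d / κ| * L < d * (κ - l) / κ → ∀ x, Φ x u ∈ ℝ ∙ e ↔ x ∈ ℝ ∙ e)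
    (hγ : ∀ a u, Φ (a • e) u = γ a u • e) (hgerm : IsSupercriticalPitchforkGerm γ 0 (d / κ)) :
    IsSupercriticalPitchfork Φ 0 (d / κ) := by
  have hgap : 0 < d * (κ - l) / κ := div_pos (mul_pos hd (sub_pos.2 h.lt)) hκ
  have hcont : ContinuousAt (fun u => |u - d / κ| * L) (d / κ) := by fun_prop
  obtain ⟨R, hR, hRu⟩ := Metric.eventually_nhds_iff.1 <|
    hcont.eventually_lt_const (u := d * (κ - l) / κ) (by simpa using hgap)
  exact isSupercriticalPitchfork_of_line h.ne_zero hR (h.jac_isSymmetric hjac)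
    (h.critSpace_eq hd.ne' hκ.ne' hjac) (fun u hu => hΦ u (hRu hu)) hγ hgerm

end IsDominantMode

theorem jac_hopfieldField (hT : HasFDerivAt T (ContinuousLinearMap.id ℝ E) 0) :
    jac (hopfieldField A T d) 0 u = u • (A : E →ₗ[ℝ] E) - d • LinearMap.id := by
  have hderiv : HasFDerivAt (fun x => hopfieldField A T d x u)
      (-(d • ContinuousLinearMap.id ℝ E) + u • A.comp (ContinuousLinearMap.id ℝ E)) 0 :=
    ((hasFDerivAt_id 0).const_smul d).neg.add ((A.hasFDerivAt.comp 0 hT).const_smul u)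
  rw [jac, hderiv.fderiv, neg_add_eq_sub, ContinuousLinearMap.comp_id]
  rfl

theorem jac_firingField (hT : HasFDerivAt T (ContinuousLinearMap.id ℝ E) 0) :
    jac (firingField A T d) 0 u = u • (A : E →ₗ[ℝ] E) - d • LinearMap.id := by
  have hT' : HasFDerivAt T (ContinuousLinearMap.id ℝ E) ((u • A) 0) := by rwa [map_zero]
  have hderiv : HasFDerivAt (fun x => firingField A T d x u)
      (-(d • ContinuousLinearMap.id ℝ E) + (ContinuousLinearMap.id ℝ E).comp (u • A)) 0 :=
    ((hasFDerivAt_id 0).const_smul d).neg.add (hT'.comp 0 (u • A).hasFDerivAt)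
  rw [jac, hderiv.fderiv, neg_add_eq_sub, ContinuousLinearMap.id_comp]
  rfl

theorem hopfieldField_smul (he : A e = κ • e) {f : ℝ → ℝ} (hT : ∀ a : ℝ, T (a • e) = f a • e)
    (a u : ℝ) : hopfieldField A T d (a • e) u = (-(d * a) + u * (κ * f a)) • e := by
  rw [hopfieldField, hT, map_smul, he]
  module

theorem firingField_smul (he : A e = κ • e) {f : ℝ → ℝ} (hT : ∀ a : ℝ, T (a • e) = f a • e)
    (a u : ℝ) : firingField A T d (a • e) u = (-(d * a) + f (u * (κ * a))) • e := by
  have hA : u • A (a • e) = (u * (κ * a)) • e := by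
    rw [map_smul, he]
    module
  rw [firingField, hA, hT]
  module

end OpinionDynamics

section Eigenvalues

variable {E : Type*} [NormedAddCommGroup E] [InnerProductSpace ℝ E] [FiniteDimensional ℝ E]
  {A : E →ₗ[ℝ] E} (hA : A.IsSymmetric) {n : ℕ} (hn : Module.finrank ℝ E = n)

theorem inner_map_self_eq_sum_eigenvalues (x : E) :
    ⟪x, A x⟫ = ∑ i, hA.eigenvalues hn i * ⟪hA.eigenvectorBasis hn i, x⟫ ^ 2 := by
  rw [← (hA.eigenvectorBasis hn).sum_inner_mul_inner]
  refine Finset.sum_congr rfl fun i _ => ?_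
  rw [← hA, hA.apply_eigenvectorBasis, RCLike.ofReal_real_eq_id, id, real_inner_smul_left,
    real_inner_comm x]
  ring

theorem inner_map_self_le_mul_norm_sq {M : ℝ} {x : E}
    (hM : ∀ i, ⟪hA.eigenvectorBasis hn i, x⟫ ≠ 0 → hA.eigenvalues hn i ≤ M) :
    ⟪x, A x⟫ ≤ M * ‖x‖ ^ 2 := by
  rw [inner_map_self_eq_sum_eigenvalues hA hn, ← (hA.eigenvectorBasis hn).sum_sq_inner_right,
    Finset.mul_sum]
  refine Finset.sum_le_sum fun i _ => ?_
  by_cases hi : ⟪hA.eigenvectorBasis hn i, x⟫ = 0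
  · simp [hi]
  · exact mul_le_mul_of_nonneg_right (hM i hi) (sq_nonneg _)

theorem mul_norm_sq_le_inner_map_self {m : ℝ} (hm : ∀ i, m ≤ hA.eigenvalues hn i) (x : E) :
    m * ‖x‖ ^ 2 ≤ ⟪x, A x⟫ := by
  rw [inner_map_self_eq_sum_eigenvalues hA hn, ← (hA.eigenvectorBasis hn).sum_sq_inner_right,
    Finset.mul_sum]
  exact Finset.sum_le_sum fun i _ => mul_le_mul_of_nonneg_right (hm i) (sq_nonneg _)

theorem eigenvalues_le_of_inner_map_self_le {M : ℝ} (hM : ∀ x, ⟪x, A x⟫ ≤ M * ‖x‖ ^ 2)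
    (i : Fin n) : hA.eigenvalues hn i ≤ M := by
  have h := hM (hA.eigenvectorBasis hn i)
  rwa [hA.apply_eigenvectorBasis, RCLike.ofReal_real_eq_id, id, real_inner_smul_right,
    real_inner_self_eq_norm_sq, (hA.eigenvectorBasis hn).norm_eq_one, one_pow, mul_one,
    mul_one] at h

theorem eigenvalues_lt_of_finrank_eigenspace_le_one {M : ℝ} (hM : ∀ i, hA.eigenvalues hn i ≤ M)
    (hrank : Module.finrank ℝ (Module.End.eigenspace A M) ≤ 1) {i j : Fin n} (hji : j < i) :
    hA.eigenvalues hn i < M := by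
  refine (hM i).lt_of_ne fun hi => hji.ne ?_
  have hj : hA.eigenvalues hn j = M := (hM j).antisymm (hi ▸ hA.eigenvalues_antitone hn hji.le)
  have hcard := (hA.card_filter_eigenvalues_eq hn M).trans_le hrank
  exact Finset.card_le_one.1 hcard j (by simpa using hj) i (by simpa using hi)

variable {e : E} {κ : ℝ}

theorem inner_eigenvectorBasis_eq_zero_of_eigenvalues_ne (he : A e = κ • e) {i : Fin n}
    (hi : hA.eigenvalues hn i ≠ κ) : ⟪hA.eigenvectorBasis hn i, e⟫ = 0 := by
  have h := hA (hA.eigenvectorBasis hn i) e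
  rw [hA.apply_eigenvectorBasis, RCLike.ofReal_real_eq_id, id, he, real_inner_smul_left,
    real_inner_smul_right] at h
  exact (mul_eq_mul_right_iff.1 h).resolve_left hi

/-- Under these hypotheses `e` is a multiple of the basis vector at `i₀`. -/
theorem inner_eigenvectorBasis_eq_zero_of_inner_eq_zero (he₀ : e ≠ 0) (he : A e = κ • e)
    {i₀ : Fin n} (hi₀ : ∀ i ≠ i₀, hA.eigenvalues hn i ≠ κ) {x : E} (hx : ⟪e, x⟫ = 0) :
    ⟪hA.eigenvectorBasis hn i₀, x⟫ = 0 := by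
  have he' : e = ⟪hA.eigenvectorBasis hn i₀, e⟫ • hA.eigenvectorBasis hn i₀ := by
    conv_lhs => rw [← (hA.eigenvectorBasis hn).sum_repr' e]
    refine Finset.sum_eq_single_of_mem i₀ (Finset.mem_univ _) fun i _ hi => ?_
    rw [inner_eigenvectorBasis_eq_zero_of_eigenvalues_ne hA hn he (hi₀ i hi), zero_smul]
  rw [he', real_inner_smul_left, mul_eq_zero] at hx
  refine hx.resolve_left fun h => he₀ ?_
  rw [he', h, zero_smul]

end Eigenvalues

theorem isDominantMode_of_eigenvalues_lt {E : Type*} [NormedAddCommGroup E]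
    [InnerProductSpace ℝ E] [FiniteDimensional ℝ E] {n : ℕ} (hn : Module.finrank ℝ E = n)
    {A : E →L[ℝ] E} (hA : (A : E →ₗ[ℝ] E).IsSymmetric) (h2 : 2 ≤ n) {e : E} {κ : ℝ}
    (he₀ : e ≠ 0) (he : A e = κ • e) (hgap : hA.eigenvalues hn ⟨1, h2⟩ < κ) :
    IsDominantMode A e κ (hA.eigenvalues hn ⟨1, h2⟩)
      (max |hA.eigenvalues hn ⟨1, h2⟩| |hA.eigenvalues hn ⟨n - 1, by omega⟩|) := by
  have hle : ∀ i : Fin n, 1 ≤ i.1 → hA.eigenvalues hn i ≤ hA.eigenvalues hn ⟨1, h2⟩ :=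
    fun i hi => hA.eigenvalues_antitone hn hi
  have hupper : ∀ z ∈ (ℝ ∙ e)ᗮ, ⟪z, A z⟫ ≤ hA.eigenvalues hn ⟨1, h2⟩ * ‖z‖ ^ 2 := fun z hz => by
    refine inner_map_self_le_mul_norm_sq hA hn fun i hi => hle i <| Nat.one_le_iff_ne_zero.2
      fun hi₀ => hi ?_
    refine inner_eigenvectorBasis_eq_zero_of_inner_eq_zero hA hn he₀ he (fun j hj => ?_)
      (Submodule.mem_orthogonal_singleton_iff_inner_right.1 hz)
    refine ((hle j <| Nat.one_le_iff_ne_zero.2 fun hj₀ => hj ?_).trans_lt hgap).ne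
    exact Fin.ext (hj₀.trans hi₀.symm)
  have hlower : ∀ z, hA.eigenvalues hn ⟨n - 1, by omega⟩ * ‖z‖ ^ 2 ≤ ⟪z, A z⟫ :=
    mul_norm_sq_le_inner_map_self hA hn fun i =>
      hA.eigenvalues_antitone hn (Fin.mk_le_mk.2 (Nat.le_sub_one_of_lt i.2))
  refine ⟨hA, he₀, he, hgap, hupper, fun z hz => abs_le.2 ⟨?_, ?_⟩⟩
  · refine le_trans ?_ (hlower z)
    rw [← neg_mul]
    gcongr
    exact (neg_le_neg (le_max_right _ _)).trans (neg_abs_le _)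
  · refine (hupper z hz).trans ?_
    gcongr
    exact (le_abs_self _).trans (le_max_left _ _)

section Entrywise

variable {V : Type*}

/-- The entrywise `tanh` on Euclidean space. -/
noncomputable def tanhMap (x : EuclideanSpace ℝ V) : EuclideanSpace ℝ V :=
  WithLp.toLp 2 fun i => Real.tanh (x i)

theorem firmlyNonexpansive_tanhMap [Fintype V] :
    FirmlyNonexpansive (tanhMap (V := V)) := fun x y => by
  rw [EuclideanSpace.norm_sq_eq, PiLp.inner_apply]
  exact Finset.sum_le_sum fun i _ => firmlyNonexpansive_tanh (x i) (y i)

theorem hasFDerivAt_tanhMap_zero [Finite V] :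
    HasFDerivAt tanhMap (ContinuousLinearMap.id ℝ (EuclideanSpace ℝ V)) 0 := by
  cases nonempty_fintype V
  rw [← hasFDerivWithinAt_univ, hasFDerivWithinAt_euclidean]
  intro i
  rw [hasFDerivWithinAt_univ]
  have hproj : HasFDerivAt (fun x : EuclideanSpace ℝ V => x i)
      (EuclideanSpace.proj (𝕜 := ℝ) i : EuclideanSpace ℝ V →L[ℝ] ℝ) 0 :=
    (EuclideanSpace.proj (𝕜 := ℝ) i : EuclideanSpace ℝ V →L[ℝ] ℝ).hasFDerivAt
  refine ((hasDerivAt_tanh ((0 : EuclideanSpace ℝ V) i)).comp_hasFDerivAt 0 hproj).congr_fderiv ?_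
  ext x
  simp

variable [Fintype V]

theorem tanhMap_smul_ones (a : ℝ) : tanhMap (a • ones V) = Real.tanh a • ones V := by
  ext i
  simp [tanhMap, ones]

theorem tanhMap_mem_span_ones : ∀ x ∈ ℝ ∙ ones V, tanhMap x ∈ ℝ ∙ ones V := by
  intro x hx
  obtain ⟨a, rfl⟩ := Submodule.mem_span_singleton.1 hx
  exact tanhMap_smul_ones (V := V) a ▸ Submodule.smul_mem _ _ (Submodule.mem_span_singleton_self _)

theorem ones_ne_zero [Nonempty V] : ones V ≠ 0 := fun h => by
  simpa [ones] using congrArg (fun x : EuclideanSpace ℝ V => x (Classical.arbitrary V)) h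

end Entrywise

section Network

variable {V : Type*} [Fintype V] [DecidableEq V] (G : SimpleGraph V) [DecidableRel G.Adj]

/-- The adjacency matrix as an operator on Euclidean space. -/
noncomputable def adjOp : EuclideanSpace ℝ V →L[ℝ] EuclideanSpace ℝ V :=
  Matrix.toEuclideanCLM (n := V) (𝕜 := ℝ) (G.adjMatrix ℝ)

theorem adjOp_apply (x : EuclideanSpace ℝ V) :
    adjOp G x = WithLp.toLp 2 ((G.adjMatrix ℝ).mulVec fun j => x j) := rfl

theorem adjOp_isSymmetric : (adjOp G : EuclideanSpace ℝ V →ₗ[ℝ] EuclideanSpace ℝ V).IsSymmetric :=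
  Matrix.isSymmetric_toEuclideanLin_iff.2 (adjMatrix_isHermitian G)

theorem hopfieldNOD_eq_hopfieldField (d : ℝ) :
    hopfieldNOD G d = hopfieldField (adjOp G) tanhMap d := rfl

theorem firingNOD_eq_firingField (d : ℝ) :
    firingNOD G d = firingField (adjOp G) tanhMap d := rfl

variable {G} {k : ℕ} (hreg : G.IsRegularOfDegree k)

include hreg in
theorem adjOp_ones : adjOp G (ones V) = (k : ℝ) • ones V := by
  ext i
  simp [adjOp_apply, ones, SimpleGraph.adjMatrix_mulVec_apply, hreg.degree_eq i]

include hreg in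
theorem lapMatrix_mulVec_eq (x : EuclideanSpace ℝ V) :
    WithLp.toLp 2 ((G.lapMatrix ℝ).mulVec fun j => x j) = (k : ℝ) • x - adjOp G x := by
  ext i
  simp [adjOp_apply, SimpleGraph.lapMatrix_mulVec_apply, SimpleGraph.adjMatrix_mulVec_apply,
    hreg.degree_eq i]

include hreg in
theorem inner_adjOp_le (x : EuclideanSpace ℝ V) : ⟪x, adjOp G x⟫ ≤ k * ‖x‖ ^ 2 := by
  have hL : 0 ≤ ⟪x, WithLp.toLp 2 ((G.lapMatrix ℝ).mulVec fun j => x j)⟫ := by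
    rw [EuclideanSpace.inner_eq_star_dotProduct, dotProduct_comm]
    exact (G.posSemidef_lapMatrix ℝ).dotProduct_mulVec_nonneg _
  rwa [lapMatrix_mulVec_eq hreg, inner_sub_right, real_inner_smul_right,
    real_inner_self_eq_norm_sq, sub_nonneg] at hL

include hreg in
theorem eigenspace_adjOp_le (hconn : G.Connected) :
    Module.End.eigenspace (adjOp G : EuclideanSpace ℝ V →ₗ[ℝ] EuclideanSpace ℝ V) k ≤
      ℝ ∙ ones V := by
  intro x hx
  have hAx : adjOp G x = (k : ℝ) • x := Module.End.mem_eigenspace_iff.1 hx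
  have hLx : (G.lapMatrix ℝ).mulVec (fun j => x j) = 0 := by
    simpa [hAx] using congrArg WithLp.ofLp (lapMatrix_mulVec_eq hreg x)
  rw [SimpleGraph.lapMatrix_mulVec_eq_zero_iff_forall_reachable] at hLx
  obtain ⟨i⟩ := hconn.nonempty
  refine Submodule.mem_span_singleton.2 ⟨x i, ?_⟩
  ext j
  simpa [ones] using hLx i j (hconn.preconnected i j)

include hreg in
theorem lambdaTwo_lt (hconn : G.Connected) (hn : 2 ≤ Fintype.card V) : lambdaTwo G hn < k := by
  have := hconn.nonempty
  refine eigenvalues_lt_of_finrank_eigenspace_le_one (adjOp_isSymmetric G) finrank_euclideanSpace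
    (eigenvalues_le_of_inner_map_self_le _ _ (inner_adjOp_le hreg)) ?_
    (j := ⟨0, by omega⟩) (Fin.mk_lt_mk.2 one_pos)
  exact (Submodule.finrank_mono (eigenspace_adjOp_le hreg hconn)).trans
    (finrank_span_singleton ones_ne_zero).le

include hreg in
theorem isDominantMode_adjOp (hconn : G.Connected) (hn : 2 ≤ Fintype.card V) :
    IsDominantMode (adjOp G) (ones V) k (lambdaTwo G hn) (lambdaPrime G hn) :=
  have := hconn.nonempty
  isDominantMode_of_eigenvalues_lt finrank_euclideanSpace (adjOp_isSymmetric G) hn ones_ne_zero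
    (adjOp_ones hreg) (lambdaTwo_lt hreg hconn hn)

omit [DecidableEq V] in
include hreg in
theorem degree_pos_of_connected (hconn : G.Connected) (hn : 2 ≤ Fintype.card V) : 0 < k := by
  have : Nontrivial V := Fintype.one_lt_card_iff_nontrivial.1 hn
  obtain ⟨i⟩ := hconn.nonempty
  exact hreg.degree_eq i ▸ hconn.preconnected.degree_pos_of_nontrivial i

end Network

end LSR

theorem mainTheorem4 {V : Type*} [Fintype V] [DecidableEq V]
    (G : SimpleGraph V) [DecidableRel G.Adj] (hconn : G.Connected)
    (k : ℕ) (hreg : G.IsRegularOfDegree k) (hn : 2 ≤ Fintype.card V)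
    (d : ℝ) (hd : 0 < d) :
    (LSR.IsSupercriticalPitchfork (LSR.hopfieldNOD G d) 0 (d / k) ∧
      LSR.critSpace (LSR.hopfieldNOD G d) 0 (d / k) = Submodule.span ℝ {LSR.ones V} ∧
      ∀ Rpar Rperp : ℝ, 0 < Rpar →
        Rpar < d * (k - LSR.lambdaTwo G hn) / (k * LSR.lambdaPrime G hn) → 0 < Rperp →
        ∃ φ, LSR.IsValidReduction (LSR.hopfieldNOD G d) 0 (d / k) Rpar Rperp φ) ∧
    (LSR.IsSupercriticalPitchfork (LSR.firingNOD G d) 0 (d / k) ∧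
      LSR.critSpace (LSR.firingNOD G d) 0 (d / k) = Submodule.span ℝ {LSR.ones V} ∧
      ∀ Rpar Rperp : ℝ, 0 < Rpar →
        Rpar < d * (k - LSR.lambdaTwo G hn) / (k * LSR.lambdaPrime G hn) → 0 < Rperp →
        ∃ φ, LSR.IsValidReduction (LSR.firingNOD G d) 0 (d / k) Rpar Rperp φ) := by
  have hmode := LSR.isDominantMode_adjOp hreg hconn hn
  have hk : (0 : ℝ) < k := Nat.cast_pos.2 (LSR.degree_pos_of_connected hreg hconn hn)
  have hT := LSR.firmlyNonexpansive_tanhMap (V := V)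
  rw [LSR.hopfieldNOD_eq_hopfieldField, LSR.firingNOD_eq_firingField]
  constructor
  · have hjac := LSR.jac_hopfieldField (A := LSR.adjOp G) (d := d) (u := d / k)
      LSR.hasFDerivAt_tanhMap_zero
    have hmem := fun u => hmode.hopfieldField_mem_iff (u := u) hd hk hT LSR.tanhMap_mem_span_ones
    exact ⟨hmode.isSupercriticalPitchfork hd hk hjac hmem
        (LSR.hopfieldField_smul hmode.apply_eq LSR.tanhMap_smul_ones)
        (LSR.isSupercriticalPitchforkGerm_hopfield hd hk),
      hmode.critSpace_eq hd.ne' hk.ne' hjac, fun Rpar Rperp _ hRpar hRperp =>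
      ⟨0, hmode.isValidReduction hd hk hjac hmem hRpar hRperp⟩⟩
  · have hjac := LSR.jac_firingField (A := LSR.adjOp G) (d := d) (u := d / k)
      LSR.hasFDerivAt_tanhMap_zero
    have hmem := fun u => hmode.firingField_mem_iff (u := u) hd hk hT LSR.tanhMap_mem_span_ones
    exact ⟨hmode.isSupercriticalPitchfork hd hk hjac hmem
        (LSR.firingField_smul hmode.apply_eq LSR.tanhMap_smul_ones)
        (LSR.isSupercriticalPitchforkGerm_firing hd hk),
      hmode.critSpace_eq hd.ne' hk.ne' hjac, fun Rpar Rperp _ hRpar hRperp =>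
      ⟨0, hmode.isValidReduction hd hk hjac hmem hRpar hRperp⟩⟩
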